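/- Let $\gamma:[0,1]\to\mathbb{R}^2$ be a polynomial curve, i.e. $\gamma(t)=(x(t),y(t))$ with $x,y$ real polynomials. A finite planar bar-joint framework $(G,p)$ is a finite simple graph $G$ together with a placement $p$ of its vertices (the joints) in $\mathbb{R}^2$ such that the two ends of every edge (bar) have distinct positions; joints may coincide and bars may cross. A continuous motion of $(G,p)$ is a family $q(t)=(q_v(t))_{v}$, $t\in[0,1]$, of placements, continuous in $t$, with $q(0)=p$ and with $|q_v(t)-q_w(t)|=|p_v-p_w|$ for every bar $vw$ and every $t\in[0,1]$. Then there is a finite planar bar-joint framework $(G,p)$ with four distinct joints $1,2,L,C$, placed at $p_1=(0,0)$, $p_2=(1,0)$, $p_L=(1,0)$, $p_C=\gamma(0)$, with the following two properties. (a) For every continuous motion $q(t)$, $t\in[0,1]$, of $(G,p)$ with $q_1(t)=p_1$ and $q_2(t)=p_2$ for all $t$, and with $q_L(t)=(1+s(t),0)$ where $s(t)\in[0,1]$ for all $t$, one has $q_C(t)=\gamma(s(t))$ for all $t\in[0,1]$. (b) There is such a motion with $s(t)=t$ for all $t\in[0,1]$. -/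

import Mathlib

open scoped unitInterval

/-- The Euclidean plane. -/
abbrev Plane : Type := EuclideanSpace ℝ (Fin 2)

/-- A curve `[0,1] → ℝ²` whose two coordinate functions are real polynomials. -/
def IsPolynomialCurve (γ : I → Plane) : Prop :=
  ∃ X Y : Polynomial ℝ, ∀ t : I, γ t = !₂[X.eval (t : ℝ), Y.eval (t : ℝ)]

/-- A planar bar-joint framework `(G, p)`: a simple graph on the joints together with a placement
of the joints in the plane, in which every bar (edge) has positive length. Joints may coincide
and bars may cross or overlap. -/
structure BarJointFramework (V : Type*) where
  graph : SimpleGraph V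
  pos : V → Plane
  pos_ne_of_adj : ∀ v w : V, graph.Adj v w → pos v ≠ pos w

/-- A continuous motion, over the time interval `[0,1]`, of a framework: every joint moves
continuously, the motion starts at the given placement, and all bar lengths are preserved. -/
structure BarJointFramework.IsMotion {V : Type*} (F : BarJointFramework V)
    (q : I → V → Plane) : Prop where
  continuous_joint : ∀ v : V, Continuous fun t => q t v
  start : q 0 = F.pos
  dist_eq : ∀ (t : I) (v w : V), F.graph.Adj v w → dist (q t v) (q t w) = dist (F.pos v) (F.pos w)

/-!
The framework is built from a single operation: attach a new joint by two bars to two joints that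
are already present, in a triangle that stays nondegenerate for every input `s ∈ [0,1]`. In a
continuous motion the two bar lengths determine the new joint up to reflection, and the
orientation of a triangle that never degenerates cannot change; so if the old joints are functions
of `s`, so is the new one, and no bracing of parallelograms or antiparallelograms is needed
(`eq_of_dist_eq`, `Linkage.attach`, `Drawable.exists_linkage`). It remains to show that polynomial
curves arise from the curves `0`, `1`, `1 + s` by this operation (`Drawable.polynomial`).

The input drives the base of an isosceles triangle with long legs `r`, which yields a unit vector
`u(s)` with `s = i r (u - 1/u) - 1` (`Drawable.exists_near_one`). A polynomial in `s` is therefore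
a Laurent polynomial in `u`, whose degree does not depend on `r` (`Drawable.exists_laurent`).
Kempe's antiparallelograms give `y² / x` from unit vectors `x`, `y`, hence all powers of `u`
(`Drawable.sq_div`, `Drawable.zpow`), and parallelograms add up the terms. For large `r` the vector
`u` is so close to `1` that the relevant powers of `u` hardly turn; this is what allows one to keep
all parallelograms nondegenerate, at the price of a detour (`Drawable.add_of_near`).
-/

open Complex ComplexConjugate

/-! ### Drawable curves -/

/-- The prescribed curves of the joints `1`, `2` and `L`, in terms of the input `s`. -/
noncomputable def baseCurve : Fin 3 → I → ℂ :=
  ![fun _ => 0, fun _ => 1, fun s => 1 + ((s : ℝ) : ℂ)]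

/-- Curves obtained from the three base curves by repeatedly attaching a new point to two old ones
by bars of constant length, in such a way that the triangle formed by the three points is never
degenerate. -/
inductive Drawable : (I → ℂ) → Prop
  | base (i : Fin 3) : Drawable (baseCurve i)
  | triangle {f g h : I → ℂ} (hf : Drawable f) (hg : Drawable g) (hh : Continuous h)
      (dist_f : ∀ s, ‖h s - f s‖ = ‖h 0 - f 0‖) (dist_g : ∀ s, ‖h s - g s‖ = ‖h 0 - g 0‖)
      (im_ne : ∀ s, ((h s - f s) * conj (h s - g s)).im ≠ 0) : Drawable h

/-! ### Linkages with prescribed motion -/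

/-- A linkage in `ℂ` whose joints `v` trace prescribed curves `path v`, as functions of the input
`s`. The field `rigid` says that a continuous motion in which the base joints follow an input
`s(t)` is forced to be `path v (s t)`: the time `t` and the input `s` are kept apart, because the
input may move back and forth. -/
structure Linkage where
  V : Type
  finite : Finite V
  graph : SimpleGraph V
  path : V → I → ℂ
  base : Fin 3 → V
  base_injective : Function.Injective base
  path_base : ∀ i, path (base i) = baseCurve i
  continuous_path : ∀ v, Continuous (path v)
  path_ne : ∀ v w, graph.Adj v w → path v 0 ≠ path w 0
  dist_path : ∀ v w, graph.Adj v w → ∀ s, dist (path v s) (path w s) = dist (path v 0) (path w 0)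
  rigid : ∀ (q : I → V → ℂ) (s : I → I), Continuous s → s 0 = 0 →
    (∀ v, Continuous fun t => q t v) → (∀ v, q 0 v = path v 0) →
    (∀ t v w, graph.Adj v w → dist (q t v) (q t w) = dist (path v 0) (path w 0)) →
    (∀ i t, q t (base i) = baseCurve i (s t)) → ∀ t v, q t v = path v (s t)

lemma continuous_baseCurve (i : Fin 3) : Continuous (baseCurve i) := by
  fin_cases i
  · exact continuous_const
  · exact continuous_const
  · change Continuous fun s : I => 1 + ((s : ℝ) : ℂ)
    fun_prop

lemma Drawable.continuous {f : I → ℂ} (hf : Drawable f) : Continuous f := by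
  cases hf with
  | base i => exact continuous_baseCurve i
  | triangle _ _ hh => exact hh

/-- The three base joints, without bars. -/
noncomputable def Linkage.initial : Linkage where
  V := Fin 3
  finite := inferInstance
  graph := ⊥
  path := baseCurve
  base := id
  base_injective := Function.injective_id
  path_base _ := rfl
  continuous_path := continuous_baseCurve
  path_ne _ _ h := h.elim
  dist_path _ _ h := h.elim
  rigid _ _ _ _ _ _ _ hb t v := hb v t

lemma im_mul_conj_sq (x y : ℂ) :
    (x * conj y).im ^ 2 = ‖x‖ ^ 2 * ‖y‖ ^ 2 - ((‖x‖ ^ 2 + ‖y‖ ^ 2 - ‖x - y‖ ^ 2) / 2) ^ 2 := by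
  simp only [Complex.sq_norm, Complex.normSq_apply, mul_im, sub_re, sub_im, conj_re, conj_im]
  ring

/-- A point moving at the same distances from two moving points as a given point, with which it
agrees initially, agrees with it forever if the triangle never degenerates: the squared oriented
area is determined by the side lengths, and its sign cannot jump. -/
lemma eq_of_dist_eq {f g h k : I → ℂ} (hf : Continuous f) (hg : Continuous g) (hh : Continuous h)
    (hk : Continuous k) (h0 : k 0 = h 0) (hkf : ∀ t, ‖k t - f t‖ = ‖h t - f t‖)
    (hkg : ∀ t, ‖k t - g t‖ = ‖h t - g t‖)
    (him : ∀ t, ((h t - f t) * conj (h t - g t)).im ≠ 0) (t : I) : k t = h t := by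
  have hsq : ∀ t, ((k t - f t) * conj (k t - g t)).im ^ 2
      = ((h t - f t) * conj (h t - g t)).im ^ 2 := fun t => by
    simp only [im_mul_conj_sq, hkf, hkg, sub_sub_sub_cancel_left]
  have hcont : ∀ {a : I → ℂ}, Continuous a →
      Continuous fun t => ((a t - f t) * conj (a t - g t)).im := fun ha =>
    Complex.continuous_im.comp ((ha.sub hf).mul (Complex.continuous_conj.comp (ha.sub hg)))
  have him_eq : ((k t - f t) * conj (k t - g t)).im = ((h t - f t) * conj (h t - g t)).im :=
    isPreconnected_univ.eq_of_sq_eq (hcont hk).continuousOn (hcont hh).continuousOn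
      (fun t _ => hsq t) (fun {t} _ => him t) (Set.mem_univ 0) (by simp only [h0])
      (Set.mem_univ t)
  have hre : ∀ x y : ℂ, (x * conj y).re = (‖x‖ ^ 2 + ‖y‖ ^ 2 - ‖x - y‖ ^ 2) / 2 := fun x y => by
    simp only [Complex.sq_norm, Complex.normSq_apply, mul_re, sub_re, sub_im, conj_re, conj_im]
    ring
  have hmul : (k t - f t) * conj (k t - g t) = (h t - f t) * conj (h t - g t) := by
    refine Complex.ext ?_ him_eq
    simp only [hre, hkf, hkg, sub_sub_sub_cancel_left]
  have hself : (k t - f t) * conj (k t - f t) = (h t - f t) * conj (h t - f t) := by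
    simp only [Complex.mul_conj, Complex.normSq_eq_norm_sq, hkf]
  have hne : conj (g t - f t) ≠ 0 := by
    intro h'
    have hgf : g t = f t := sub_eq_zero.mp ((map_eq_zero _).mp h')
    exact him t (by rw [hgf, Complex.mul_conj, ofReal_im])
  have : (k t - h t) * conj (g t - f t) = 0 := by
    simp only [map_sub] at *
    linear_combination hself - hmul
  exact sub_eq_zero.mp ((mul_eq_zero.mp this).resolve_right hne)

/-- The graph on `Option V` joining a new vertex to `a` and `b`. -/
def attachGraph {V : Type} (G : SimpleGraph V) (a b : V) : SimpleGraph (Option V) where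
  Adj
    | none, none => False
    | none, some w => w = a ∨ w = b
    | some v, none => v = a ∨ v = b
    | some v, some w => G.Adj v w
  symm := ⟨by
    rintro (_ | v) (_ | w) h
    · exact h
    · exact h
    · exact h
    · exact G.adj_symm h⟩
  loopless := ⟨by
    rintro (_ | v) h
    · exact h
    · exact G.loopless.irrefl v h⟩

/-- Attaching a new joint with path `h` to two joints of a linkage, in a never degenerate
triangle. -/
def Linkage.attach (Λ : Linkage) (a b : Λ.V) (h : I → ℂ) (hh : Continuous h)
    (dist_a : ∀ s, ‖h s - Λ.path a s‖ = ‖h 0 - Λ.path a 0‖)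
    (dist_b : ∀ s, ‖h s - Λ.path b s‖ = ‖h 0 - Λ.path b 0‖)
    (im_ne : ∀ s, ((h s - Λ.path a s) * conj (h s - Λ.path b s)).im ≠ 0) : Linkage where
  V := Option Λ.V
  finite := have := Λ.finite; inferInstance
  graph := attachGraph Λ.graph a b
  path v := v.elim h Λ.path
  base i := some (Λ.base i)
  base_injective := (Option.some_injective _).comp Λ.base_injective
  path_base := Λ.path_base
  continuous_path
    | none => hh
    | some v => Λ.continuous_path v
  path_ne := by
    have ha : h 0 ≠ Λ.path a 0 := fun e => im_ne 0 (by simp [e])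
    have hb : h 0 ≠ Λ.path b 0 := fun e => im_ne 0 (by simp [e])
    rintro (_ | v) (_ | w) hvw
    · exact hvw.elim
    · rcases hvw with rfl | rfl
      exacts [ha, hb]
    · rcases hvw with rfl | rfl
      exacts [ha.symm, hb.symm]
    · exact Λ.path_ne v w hvw
  dist_path := by
    rintro (_ | v) (_ | w) hvw s
    · exact hvw.elim
    · rcases hvw with rfl | rfl
      · simpa [dist_eq_norm] using dist_a s
      · simpa [dist_eq_norm] using dist_b s
    · rcases hvw with rfl | rfl
      · simpa [dist_eq_norm, norm_sub_rev] using dist_a s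
      · simpa [dist_eq_norm, norm_sub_rev] using dist_b s
    · exact Λ.dist_path v w hvw s
  rigid q s hs hs0 hq hq0 hdist hb := by
    have old : ∀ t v, q t (some v) = Λ.path v (s t) :=
      Λ.rigid (fun t v => q t (some v)) s hs hs0 (fun v => hq (some v)) (fun v => hq0 (some v))
        (fun t v w hvw => hdist t (some v) (some w) hvw) hb
    rintro t (_ | v)
    · refine eq_of_dist_eq (f := fun t => Λ.path a (s t)) (g := fun t => Λ.path b (s t))
        (h := fun t => h (s t)) (k := fun t => q t none) ((Λ.continuous_path a).comp hs)
        ((Λ.continuous_path b).comp hs) (hh.comp hs) (hq none) ?_ ?_ ?_ (fun t => im_ne (s t)) t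
      · simpa [hs0] using hq0 none
      · intro t
        have := hdist t none (some a) (Or.inl rfl)
        simp only [old, dist_eq_norm] at this
        exact this.trans (dist_a (s t)).symm
      · intro t
        have := hdist t none (some b) (Or.inr rfl)
        simp only [old, dist_eq_norm] at this
        exact this.trans (dist_b (s t)).symm
    · exact old t v

/-- A drawable curve can be traced by a joint of some enlargement of any given linkage; keeping
the given curves lets the two parents of a new joint be realized one after the other. -/
lemma Drawable.exists_linkage {h : I → ℂ} (hh : Drawable h) (Λ : Linkage) :
    ∃ Λ' : Linkage, Set.range Λ.path ⊆ Set.range Λ'.path ∧ h ∈ Set.range Λ'.path := by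
  induction hh generalizing Λ with
  | base i => exact ⟨Λ, subset_rfl, Λ.base i, Λ.path_base i⟩
  | @triangle f g h _ _ hh dist_f dist_g im_ne ihf ihg =>
    obtain ⟨Λ₁, hΛ₁, hf⟩ := ihf Λ
    obtain ⟨Λ₂, hΛ₂, b, rfl⟩ := ihg Λ₁
    obtain ⟨a, rfl⟩ := hΛ₂ hf
    refine ⟨Λ₂.attach a b h hh dist_f dist_g im_ne, (hΛ₁.trans hΛ₂).trans ?_, none, rfl⟩
    rintro _ ⟨v, rfl⟩
    exact ⟨some v, rfl⟩

/-! ### Rotation and reflection -/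

namespace Drawable

lemma zero : Drawable fun _ => 0 := base 0

lemma one : Drawable fun _ => 1 := base 1

lemma input : Drawable fun s => 1 + ((s : ℝ) : ℂ) := base 2

/-- Two drawable points at constant distance carry a rigid body, hence all points at a fixed
position relative to them. Points collinear with them are reached through a point off their
line. -/
lemma rotate {f g : I → ℂ} {ρ : ℝ} (hf : Drawable f) (hg : Drawable g) (hρ : ρ ≠ 0)
    (hfg : ∀ s, ‖g s - f s‖ = ρ) (c : ℂ) : Drawable fun s => f s + c * (g s - f s) := by
  have key : ∀ (s : I) (z w : ℂ), ((z * (g s - f s)) * conj (w * (g s - f s))).im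
      = ρ ^ 2 * (z * conj w).im := fun s z w => by
    rw [← hfg s, ← Complex.im_ofReal_mul, ← Complex.normSq_eq_norm_sq, ← Complex.mul_conj, map_mul]
    congr 1
    ring
  have hcont : ∀ c : ℂ, Continuous fun s => f s + c * (g s - f s) := fun c =>
    hf.continuous.add (continuous_const.mul (hg.continuous.sub hf.continuous))
  have offLine : ∀ c : ℂ, c.im ≠ 0 → Drawable fun s => f s + c * (g s - f s) := fun c hc => by
    have e : ∀ s, f s + c * (g s - f s) - g s = (c - 1) * (g s - f s) := fun s => by ring
    refine triangle hf hg (hcont c) (fun s => ?_) (fun s => ?_) (fun s => ?_)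
    · simp only [add_sub_cancel_left, norm_mul, hfg]
    · simp only [e, norm_mul, hfg]
    · rw [e, add_sub_cancel_left, key]
      refine mul_ne_zero (pow_ne_zero 2 hρ) ?_
      simp only [mul_im, conj_re, conj_im, sub_re, sub_im, one_re, one_im]
      intro h
      exact hc (by linarith)
  by_cases hc : c.im = 0
  · by_cases hc0 : c = 0
    · simpa [hc0] using hf
    have hre : c.re ≠ 0 := fun h => hc0 (Complex.ext h hc)
    have e : ∀ s, f s + c * (g s - f s) - (f s + Complex.I * (g s - f s)) = (c - Complex.I) * (g s - f s) :=
      fun s => by ring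
    refine triangle hf (offLine Complex.I (by simp)) (hcont c) (fun s => ?_) (fun s => ?_) (fun s => ?_)
    · simp only [add_sub_cancel_left, norm_mul, hfg]
    · simp only [e, norm_mul, hfg]
    · rw [e, add_sub_cancel_left, key]
      refine mul_ne_zero (pow_ne_zero 2 hρ) ?_
      simpa [hc] using hre
  · exact offLine c hc

lemma const_mul {f : I → ℂ} (hf : Drawable f) (hf1 : ∀ s, ‖f s‖ = 1) (c : ℂ) :
    Drawable fun s => c * f s := by
  simpa using rotate zero hf one_ne_zero (by simpa using hf1) c

/-- The triangle rule in a moving frame, rotated by a unimodular function `x`. -/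
lemma triangle_mul {x a b h : I → ℂ} (hx : Continuous x) (hx1 : ∀ s, ‖x s‖ = 1)
    (ha : Drawable fun s => x s * a s) (hb : Drawable fun s => x s * b s) (hh : Continuous h)
    {α β : ℝ} (hα : ∀ s, ‖h s - a s‖ = α) (hβ : ∀ s, ‖h s - b s‖ = β)
    (him : ∀ s, ((h s - a s) * conj (h s - b s)).im ≠ 0) : Drawable fun s => x s * h s := by
  refine triangle ha hb (hx.mul hh) (fun s => ?_) (fun s => ?_) (fun s => ?_)
  · simp only [← mul_sub, norm_mul, hx1, hα]
  · simp only [← mul_sub, norm_mul, hx1, hβ]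
  · have hxx : x s * conj (x s) = 1 := by
      rw [Complex.mul_conj, Complex.normSq_eq_norm_sq, hx1]
      simp
    have e : (x s * h s - x s * a s) * conj (x s * h s - x s * b s)
        = (h s - a s) * conj (h s - b s) := by
      rw [← mul_sub, ← mul_sub, map_mul]
      linear_combination (h s - a s) * conj (h s - b s) * hxx
    rw [e]
    exact him s

/-- Kempe's angle doubling, in the frame rotated by `x`. With `v = y / x`, the points `0`, `2`,
`c = v + 2 * ω`, `v` are the vertices of an antiparallelogram with sides `2` and `1`; the points
`0`, `v`, `e = v + ω / 2`, `v ^ 2 / 2` are those of a similar one of half the size, which has the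
side from `0` to `v` in common with the first and has `e` on the side from `v` to `c`. -/
lemma sq_div {x y : I → ℂ} (hx : Drawable x) (hy : Drawable y) (hx1 : ∀ s, ‖x s‖ = 1)
    (hy1 : ∀ s, ‖y s‖ = 1) (him : ∀ s, (y s / x s).im ≠ 0) :
    Drawable fun s => y s ^ 2 / x s := by
  have hx0 : ∀ s, x s ≠ 0 := fun s => norm_ne_zero_iff.mp (by simp [hx1 s])
  obtain ⟨v, hv⟩ : ∃ v : I → ℂ, ∀ s, v s = y s / x s := ⟨_, fun _ => rfl⟩
  simp only [← hv] at him
  have hvc : Continuous v := by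
    rw [funext hv]
    exact hy.continuous.div hx.continuous hx0
  have hv1 : ∀ s, ‖v s‖ = 1 := fun s => by rw [hv, norm_div, hx1, hy1, div_one]
  have hvv : ∀ s, v s * conj (v s) = 1 := fun s => by
    rw [Complex.mul_conj, Complex.normSq_eq_norm_sq, hv1]
    simp
  have hv2 : ∀ s, conj (v s) - 2 ≠ 0 := fun s h => by
    have := congrArg Complex.im h
    simp [him s] at this
  obtain ⟨ω, hω⟩ : ∃ ω : I → ℂ, ∀ s, ω s = (v s - 2) / (conj (v s) - 2) := ⟨_, fun _ => rfl⟩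
  have hωc : Continuous ω := by
    rw [funext hω]
    exact (hvc.sub continuous_const).div
      ((Complex.continuous_conj.comp hvc).sub continuous_const) hv2
  have hωv : ∀ s, ω s * (conj (v s) - 2) = v s - 2 := fun s => by
    rw [hω, div_mul_cancel₀ _ (hv2 s)]
  have hω1 : ∀ s, ‖ω s‖ = 1 := fun s => by
    have : ‖conj (v s) - 2‖ = ‖v s - 2‖ := by
      rw [← Complex.norm_conj (v s - 2), map_sub, Complex.conj_ofNat]
    rw [hω, norm_div, ← this, div_self (norm_ne_zero_iff.mpr (hv2 s))]
  have hωω : ∀ s, ω s * conj (ω s) = 1 := fun s => by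
    rw [Complex.mul_conj, Complex.normSq_eq_norm_sq, hω1]
    simp
  have h_two : Drawable fun s => x s * 2 := by
    simpa only [mul_comm] using hx.const_mul hx1 2
  have h_v : Drawable fun s => x s * v s := by
    convert hy using 2 with s
    rw [hv, mul_div_cancel₀ _ (hx0 s)]
  have h_c : Drawable fun s => x s * (v s + 2 * ω s) := by
    have e : ∀ s, v s + 2 * ω s - 2 = ω s * conj (v s) := fun s => by
      linear_combination -hωv s
    refine triangle_mul hx.continuous hx1 h_two h_v (by fun_prop) (α := 1) (β := 2)
      (fun s => ?_) (fun s => ?_) (fun s => ?_)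
    · rw [e, norm_mul, Complex.norm_conj, hω1, hv1, one_mul]
    · rw [add_sub_cancel_left, norm_mul, hω1]
      simp
    · have e' : ω s * conj (v s) * conj (2 * ω s) = 2 * conj (v s) := by
        rw [map_mul, Complex.conj_ofNat]
        linear_combination 2 * conj (v s) * hωω s
      rw [e, add_sub_cancel_left, e']
      simpa using him s
  have h_e : Drawable fun s => x s * (v s + 1 / 2 * ω s) := by
    convert rotate h_v h_c two_ne_zero (fun s => ?_) (1 / 4) using 2 with s
    · ring
    · rw [← mul_sub, add_sub_cancel_left, norm_mul, norm_mul, hx1, hω1]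
      simp
  have h_sq : Drawable fun s => x s * (v s ^ 2 / 2) := by
    have e : ∀ s, v s ^ 2 / 2 - (v s + 1 / 2 * ω s) = -(v s * ω s) := fun s => by
      linear_combination (-v s / 2) * hωv s + ω s / 2 * hvv s
    refine triangle_mul hx.continuous hx1 (a := fun _ => 0) (by simpa using zero) h_e
      (by fun_prop) (α := 1 / 2) (β := 1) (fun s => ?_) (fun s => ?_) (fun s => ?_)
    · simp [hv1]
    · rw [e, norm_neg, norm_mul, hω1, hv1, one_mul]
    · -- the value is `-v * conj ω / 2`, and `v * conj ω * |v - 2| ^ 2 = 4 * v - 4 + conj v`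
      have hωv' : conj (ω s) * (v s - 2) = conj (v s) - 2 := by
        simpa only [map_mul, map_sub, Complex.conj_conj, Complex.conj_ofNat] using
          congrArg conj (hωv s)
      have e' : (v s ^ 2 / 2 - 0) * conj (-(v s * ω s)) * (Complex.normSq (v s - 2) : ℂ)
          = -(4 * v s - 4 + conj (v s)) / 2 := by
        rw [← Complex.mul_conj]
        simp only [map_neg, map_mul, map_sub, Complex.conj_ofNat]
        linear_combination (-(v s) ^ 2 * conj (v s) * (conj (v s) - 2) / 2) * hωv'
          - (v s * conj (v s) ^ 2 - 4 * v s * conj (v s) + conj (v s) + 4 * v s - 4) / 2 * hvv s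
      rw [e]
      intro h0
      have := congrArg Complex.im e'
      rw [Complex.im_mul_ofReal, h0, zero_mul] at this
      have h3 : (-(4 * v s - 4 + conj (v s)) / 2).im = -(3 * (v s).im) / 2 := by
        simp
        ring
      rw [h3] at this
      exact him s (by linarith)
  convert rotate zero h_sq (ρ := 1 / 2) (by norm_num) (fun s => ?_) 2 using 2 with s
  · rw [hv]
    field_simp [hx0 s]
    ring
  · simp [hx1, hv1]

/-- All integer powers of a nonreal unimodular function: `sq_div` extends a pair of consecutive
powers in both directions. -/
lemma zpow {u : I → ℂ} (hu : Drawable u) (hu1 : ∀ s, ‖u s‖ = 1) (him : ∀ s, (u s).im ≠ 0)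
    (k : ℤ) : Drawable fun s => u s ^ k := by
  have hu0 : ∀ s, u s ≠ 0 := fun s => norm_ne_zero_iff.mp (by simp [hu1 s])
  have hnorm : ∀ (k : ℤ) (s : I), ‖u s ^ k‖ = 1 := fun k s => by rw [norm_zpow, hu1, one_zpow]
  suffices h : (Drawable fun s => u s ^ k) ∧ Drawable fun s => u s ^ (k + 1) from h.1
  induction k using Int.induction_on with
  | zero => simpa using ⟨one, hu⟩
  | succ k ih =>
    refine ⟨ih.2, ?_⟩
    convert sq_div ih.1 ih.2 (hnorm _) (hnorm _) (fun s => ?_) using 2 with s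
    · rw [← zpow_natCast, ← zpow_mul, ← zpow_sub₀ (hu0 s)]
      congr 1
      push_cast
      ring
    · rw [← zpow_sub₀ (hu0 s), add_sub_cancel_left, zpow_one]
      exact him s
  | pred k ih =>
    refine ⟨?_, by simpa using ih.1⟩
    convert sq_div ih.2 ih.1 (hnorm _) (hnorm _) (fun s => ?_) using 2 with s
    · rw [← zpow_natCast, ← zpow_mul, ← zpow_sub₀ (hu0 s)]
      congr 1
      push_cast
      ring
    · rw [← zpow_sub₀ (hu0 s), sub_add_cancel_left, zpow_neg_one, Complex.inv_im]
      exact div_ne_zero (neg_ne_zero.mpr (him s)) (Complex.normSq_eq_zero.not.mpr (hu0 s))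

/-! ### Addition -/

lemma parallelogram {f a b : I → ℂ} (hf : Drawable f) (hfa : Drawable fun s => f s + a s)
    (hfb : Drawable fun s => f s + b s) {α β : ℝ} (ha : ∀ s, ‖a s‖ = α) (hb : ∀ s, ‖b s‖ = β)
    (him : ∀ s, (a s * conj (b s)).im ≠ 0) : Drawable fun s => f s + a s + b s := by
  have ea : ∀ s, f s + a s + b s - (f s + b s) = a s := fun s => by ring
  have hbc : Continuous fun s => f s + b s - f s := hfb.continuous.sub hf.continuous
  simp only [add_sub_cancel_left] at hbc
  refine triangle hfb hfa (hfa.continuous.add hbc) (fun s => ?_) (fun s => ?_) (fun s => ?_)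
  · simp only [ea, ha]
  · simp only [add_sub_cancel_left, hb]
  · rw [ea, add_sub_cancel_left]
    exact him s

/-- Addition of vectors that may become parallel but whose quotient stays close to a constant
`κ`: the side `x` is replaced by a detour `c * x`, `(1 - c) * x`, both parts of which stay
transversal to `w`. -/
lemma add_of_near {f w x z : I → ℂ} {κ : ℂ} {ρ : ℝ} (hf : Drawable f)
    (hfw : Drawable fun s => f s + w s) (hfx : Drawable fun s => f s + x s) (hρ : ρ ≠ 0)
    (hw : ∀ s, ‖w s‖ = ρ) (hz : ∀ s, ‖z s‖ = 1) (hz1 : ∀ s, ‖z s - 1‖ ≤ 1 / 2)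
    (hx : ∀ s, x s = κ * (z s * w s)) : Drawable fun s => f s + x s + w s := by
  by_cases hκ : κ = 0
  · simpa [hx, hκ] using hfw
  have hxn : ∀ s, ‖x s‖ = ‖κ‖ * ρ := fun s => by rw [hx, norm_mul, norm_mul, hz, hw, one_mul]
  have hre : ∀ s, 1 / 2 ≤ (z s).re := fun s => by
    have := (abs_le.mp ((Complex.abs_re_le_norm _).trans (hz1 s))).1
    rw [sub_re, one_re] at this
    linarith
  have hww : ∀ s (a : ℂ), (a * w s * conj (w s)).im = ρ ^ 2 * a.im := fun s a => by
    rw [mul_assoc, Complex.mul_conj, Complex.im_mul_ofReal, Complex.normSq_eq_norm_sq, hw,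
      mul_comm]
  obtain ⟨M, hM⟩ : ∃ M : ℝ, M = 2 * ‖κ‖ + 1 := ⟨_, rfl⟩
  have hMpos : 0 < M := by
    rw [hM]
    positivity
  obtain ⟨c, hc⟩ : ∃ c : ℂ, c = Complex.I * M / κ := ⟨_, rfl⟩
  have hcκ : c * κ = Complex.I * M := by rw [hc, div_mul_cancel₀ _ hκ]
  have hfc : Drawable fun s => f s + c * x s := by
    simpa using rotate hf hfx (mul_ne_zero (norm_ne_zero_iff.mpr hκ) hρ) (by simpa using hxn) c
  have hfcw : Drawable fun s => f s + c * x s + w s := by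
    refine parallelogram hf hfc hfw (α := ‖c‖ * (‖κ‖ * ρ)) (fun s => ?_) hw (fun s => ?_)
    · rw [norm_mul, hxn]
    · have e : c * x s = Complex.I * M * z s * w s := by
        rw [hx]
        linear_combination z s * w s * hcκ
      rw [e, hww]
      refine mul_ne_zero (pow_ne_zero 2 hρ) ?_
      have : (Complex.I * M * z s).im = M * (z s).re := by simp
      rw [this]
      exact (mul_pos hMpos (by linarith [hre s])).ne'
  have hsum : Drawable fun s => f s + c * x s + (1 - c) * x s + w s := by
    refine parallelogram hfc ?_ hfcw (α := ‖1 - c‖ * (‖κ‖ * ρ)) (fun s => ?_) hw (fun s => ?_)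
    · convert hfx using 2 with s
      ring
    · rw [norm_mul, hxn]
    · have e : (1 - c) * x s = (κ * z s - Complex.I * M * z s) * w s := by
        rw [hx]
        linear_combination -z s * w s * hcκ
      rw [e, hww]
      refine mul_ne_zero (pow_ne_zero 2 hρ) ?_
      have h1 : (κ * z s - Complex.I * M * z s).im = (κ * z s).im - M * (z s).re := by simp
      have h2 : (κ * z s).im ≤ ‖κ‖ := by
        have := (le_abs_self _).trans (Complex.abs_im_le_norm (κ * z s))
        rwa [norm_mul, hz, mul_one] at this
      have h3 : M * (1 / 2) ≤ M * (z s).re := mul_le_mul_of_nonneg_left (hre s) hMpos.le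
      rw [h1]
      linarith
  convert hsum using 2 with s
  ring

/-- Laurent polynomials in a function whose relevant powers stay close to `1`. -/
lemma sum_zpow {u : I → ℂ} (hu : Drawable u) (hu1 : ∀ s, ‖u s‖ = 1) (him : ∀ s, (u s).im ≠ 0)
    {N : ℕ} (hN : ∀ (k : ℤ) (s : I), |k| ≤ N → ‖u s ^ k - 1‖ ≤ 1 / 2) (c : ℕ → ℂ) (e : ℤ)
    {m : ℕ} (hm : m ≤ N + 1) :
    Drawable fun s => ∑ k ∈ Finset.range m, c k * u s ^ ((k : ℤ) + e) := by
  have hu0 : ∀ s, u s ≠ 0 := fun s => norm_ne_zero_iff.mp (by simp [hu1 s])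
  have hnorm : ∀ (k : ℤ) (s : I), ‖u s ^ k‖ = 1 := fun k s => by rw [norm_zpow, hu1, one_zpow]
  induction m using Nat.strong_induction_on with
  | _ m ih =>
  cases m with
  | zero => simpa using zero
  | succ m =>
    by_cases hc : c m = 0
    · simpa [Finset.sum_range_succ, hc] using ih m (Nat.lt_succ_self m) (by omega)
    -- the last term is carried along the partial sums
    have carry : ∀ j ≤ m, Drawable fun s =>
        ∑ k ∈ Finset.range j, c k * u s ^ ((k : ℤ) + e) + c m * u s ^ ((m : ℤ) + e) := by
      intro j hj
      induction j with
      | zero => simpa using (zpow hu hu1 him _).const_mul (hnorm _) (c m)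
      | succ j ihj =>
        simp only [Finset.sum_range_succ]
        refine add_of_near (κ := c j / c m) (z := fun s => u s ^ ((j : ℤ) - m)) (ρ := ‖c m‖)
          (ih j (by omega) (by omega)) (ihj (by omega)) ?_ (norm_ne_zero_iff.mpr hc)
          (fun s => ?_) (hnorm _) (fun s => hN _ s ?_) (fun s => ?_)
        · simpa only [Finset.sum_range_succ] using ih (j + 1) (by omega) (by omega)
        · rw [norm_mul, hnorm, mul_one]
        · rw [abs_le]
          omega
        · have : u s ^ ((j : ℤ) + e) = u s ^ ((j : ℤ) - m) * u s ^ ((m : ℤ) + e) := by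
            rw [← zpow_add₀ (hu0 s)]
            congr 1
            ring
          rw [this]
          field_simp
    simpa only [Finset.sum_range_succ] using carry m le_rfl

/-! ### Polynomial curves -/

lemma norm_zpow_sub_one_le {z : ℂ} (hz : ‖z‖ = 1) (k : ℤ) :
    ‖z ^ k - 1‖ ≤ |(k : ℝ)| * ‖z - 1‖ := by
  have hz0 : z ≠ 0 := norm_ne_zero_iff.mp (by simp [hz])
  have nat : ∀ n : ℕ, ‖z ^ n - 1‖ ≤ n * ‖z - 1‖ := fun n => by
    induction n with
    | zero => simp
    | succ n ih =>
      have e : z ^ (n + 1) - 1 = z ^ n * (z - 1) + (z ^ n - 1) := by ring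
      calc ‖z ^ (n + 1) - 1‖ ≤ ‖z ^ n * (z - 1)‖ + ‖z ^ n - 1‖ := e ▸ norm_add_le _ _
        _ ≤ ‖z - 1‖ + n * ‖z - 1‖ := by
          rw [norm_mul, norm_pow, hz, one_pow, one_mul]
          gcongr
        _ = (n + 1 : ℕ) * ‖z - 1‖ := by
          push_cast
          ring
  obtain ⟨n, rfl | rfl⟩ := k.eq_nat_or_neg
  · simpa using nat n
  · have e : z ^ (-(n : ℤ)) - 1 = -(z ^ (-(n : ℤ)) * (z ^ n - 1)) := by
      rw [zpow_neg, zpow_natCast]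
      field_simp
      ring
    rw [e, norm_neg, norm_mul, norm_zpow, hz, one_zpow, one_mul]
    simpa using nat n

/-- The driving isosceles triangle: its apex over the segment from `0` to the input joint
`1 + s`, with legs `r`, turned by `-π / 2` and scaled by `1 / r`. For large `r` it stays close
to `1`, and the input is recovered from it rationally. -/
lemma exists_near_one (N : ℕ) : ∃ (r : ℝ) (u : I → ℂ), Drawable u ∧ (∀ s, ‖u s‖ = 1) ∧
    (∀ s, (u s).im ≠ 0) ∧ (∀ s, N * ‖u s - 1‖ ≤ 1 / 2) ∧
    ∀ s : I, ((s : ℝ) : ℂ) = Complex.I * r * (u s - (u s)⁻¹) - 1 := by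
  obtain ⟨r, hr⟩ : ∃ r : ℝ, r = 4 * (N + 1) := ⟨_, rfl⟩
  have hr4 : 4 ≤ r := by
    rw [hr]
    linarith [Nat.cast_nonneg (α := ℝ) N]
  have hr0 : 0 < r := by linarith
  obtain ⟨a, ha⟩ : ∃ a : I → ℝ, ∀ s, a s = (1 + (s : ℝ)) / (2 * r) := ⟨_, fun _ => rfl⟩
  have ha0 : ∀ s, 0 < a s := fun s => by
    rw [ha]
    have := s.2.1
    positivity
  have har : ∀ s, a s ≤ 1 / r := fun s => by
    rw [ha, div_le_div_iff₀ (by positivity) hr0]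
    nlinarith [s.2.2]
  have ha1 : ∀ s, a s ≤ 1 / 4 := fun s =>
    (har s).trans (one_div_le_one_div_of_le (by norm_num) hr4)
  have hac : Continuous a := by
    rw [funext ha]
    fun_prop
  obtain ⟨b, hb⟩ : ∃ b : I → ℝ, ∀ s, b s = √(1 - a s ^ 2) := ⟨_, fun _ => rfl⟩
  have hbc : Continuous b := by
    rw [funext hb]
    fun_prop
  have hbsq : ∀ s, b s ^ 2 = 1 - a s ^ 2 := fun s => by
    rw [hb, Real.sq_sqrt]
    nlinarith [ha0 s, ha1 s]
  have hb0 : ∀ s, 0 < b s := fun s => by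
    rw [hb, Real.sqrt_pos]
    nlinarith [ha0 s, ha1 s]
  have hb1 : ∀ s, 1 - a s ^ 2 ≤ b s := fun s => by
    rw [← hbsq]
    nlinarith [hb0 s, hbsq s, sq_nonneg (a s)]
  have hnorm : ∀ z : ℂ, Complex.normSq z = 1 → ‖z‖ = 1 := fun z h => by
    rw [Complex.normSq_eq_norm_sq] at h
    exact (pow_eq_one_iff_of_nonneg (norm_nonneg z) two_ne_zero).mp h
  have hn1 : ∀ s, ‖(⟨a s, b s⟩ : ℂ)‖ = 1 := fun s => hnorm _ (by
    rw [Complex.normSq_mk]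
    linarith [hbsq s])
  have hn2 : ∀ s, ‖(⟨-a s, b s⟩ : ℂ)‖ = 1 := fun s => hnorm _ (by
    rw [Complex.normSq_mk]
    linarith [hbsq s])
  have hapex : Drawable fun s => (r : ℂ) * ⟨a s, b s⟩ := by
    have hinput : ∀ s : I, (r : ℂ) * ⟨a s, b s⟩ - (1 + ((s : ℝ) : ℂ)) = r * ⟨-a s, b s⟩ :=
      fun s => by
        refine Complex.ext ?_ ?_
        · simp [ha]
          field_simp
          ring
        · simp
    refine triangle zero input ?_ (fun s => ?_) (fun s => ?_) (fun s => ?_)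
    · have : (fun s => (⟨a s, b s⟩ : ℂ)) = fun s => (a s : ℂ) + b s * Complex.I := by
        funext s
        exact Complex.mk_eq_add_mul_I _ _
      refine continuous_const.mul ?_
      rw [this]
      fun_prop
    · simp only [sub_zero, norm_mul, hn1]
    · simp only [hinput, norm_mul, hn2]
    · rw [hinput]
      have : (((r : ℂ) * ⟨a s, b s⟩ - 0) * conj ((r : ℂ) * ⟨-a s, b s⟩)).im
          = -(2 * (r ^ 2 * (a s * b s))) := by
        simp
        ring
      rw [this]
      have := mul_pos (pow_pos hr0 2) (mul_pos (ha0 s) (hb0 s))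
      linarith
  refine ⟨r, fun s => ⟨b s, -a s⟩, ?_, fun s => hnorm _ ?_, fun s => ?_, fun s => ?_,
    fun s => ?_⟩
  · have hr0' : (r : ℂ) ≠ 0 := by exact_mod_cast hr0.ne'
    convert rotate zero hapex hr0.ne' (fun s => ?_) (-Complex.I / r) using 2 with s
    · rw [sub_zero, zero_add, ← mul_assoc, div_mul_cancel₀ _ hr0']
      refine Complex.ext ?_ ?_ <;> simp
    · rw [sub_zero, norm_mul, hn1, mul_one, Complex.norm_real, Real.norm_of_nonneg hr0.le]
  · rw [Complex.normSq_mk]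
    linarith [hbsq s]
  · exact neg_ne_zero.mpr (ha0 s).ne'
  · have hsq : ‖(⟨b s, -a s⟩ : ℂ) - 1‖ ^ 2 ≤ (2 / r) ^ 2 := by
      rw [← Complex.normSq_eq_norm_sq, Complex.normSq_apply]
      simp only [sub_re, sub_im, one_re, one_im]
      have h1 : a s ^ 2 ≤ (1 / r) ^ 2 := pow_le_pow_left₀ (ha0 s).le (har s) 2
      have h2 : (2 / r) ^ 2 = 4 * (1 / r) ^ 2 := by ring
      nlinarith [hb1 s, hbsq s, sq_nonneg (1 / r)]
    have hle := abs_le_of_sq_le_sq' hsq (by positivity)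
    calc (N : ℝ) * ‖(⟨b s, -a s⟩ : ℂ) - 1‖ ≤ N * (2 / r) :=
          mul_le_mul_of_nonneg_left hle.2 (Nat.cast_nonneg N)
      _ ≤ 1 / 2 := by
          rw [mul_div_assoc', div_le_div_iff₀ hr0 (by norm_num), hr]
          linarith
  · have hinv : (⟨b s, -a s⟩ : ℂ)⁻¹ = ⟨b s, a s⟩ := by
      rw [Complex.inv_eq_conj (hnorm _ _)]
      · refine Complex.ext ?_ ?_ <;> simp
      · rw [Complex.normSq_mk]
        linarith [hbsq s]
    rw [hinv]
    refine Complex.ext ?_ ?_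
    · simp [ha]
      field_simp
      ring
    · simp

open Polynomial in
/-- Substituting `I * r * (u - u⁻¹) - 1` into a polynomial of degree `n` gives a Laurent polynomial
in `u` with exponents between `-n` and `n`. -/
lemma exists_laurent (P : ℂ[X]) (r : ℝ) : ∃ Q : ℂ[X], Q.natDegree ≤ 2 * P.natDegree ∧
    ∀ u : ℂ, u ≠ 0 → P.eval (Complex.I * r * (u - u⁻¹) - 1) * u ^ P.natDegree = Q.eval u := by
  refine ⟨∑ j ∈ Finset.range (P.natDegree + 1), C (P.coeff j) *
    (C (Complex.I * r) * (X ^ 2 - 1) - X) ^ j * X ^ (P.natDegree - j), ?_, fun u hu => ?_⟩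
  · refine natDegree_sum_le_of_forall_le _ _ fun j hj => ?_
    have hj' : j ≤ P.natDegree := Nat.lt_succ_iff.mp (Finset.mem_range.mp hj)
    have h2 : (C (Complex.I * r) * (X ^ 2 - 1) - X : ℂ[X]).natDegree ≤ 2 := by compute_degree
    have h3 : (C (P.coeff j) * (C (Complex.I * r) * (X ^ 2 - 1) - X) ^ j *
        X ^ (P.natDegree - j) : ℂ[X]).natDegree ≤ j * 2 + (P.natDegree - j) := by
      refine natDegree_mul_le_of_le ((natDegree_C_mul_le _ _).trans ?_) (natDegree_X_pow_le _)
      exact natDegree_pow_le_of_le j h2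
    omega
  · rw [eval_eq_sum_range, eval_finsetSum, Finset.sum_mul]
    refine Finset.sum_congr rfl fun j hj => ?_
    have hj' : j ≤ P.natDegree := Nat.lt_succ_iff.mp (Finset.mem_range.mp hj)
    simp only [eval_mul, eval_pow, eval_sub, eval_C, eval_X, eval_one]
    have e : Complex.I * r * (u ^ 2 - 1) - u = (Complex.I * r * (u - u⁻¹) - 1) * u := by
      field_simp
    rw [e, mul_pow, ← Nat.add_sub_cancel' hj', pow_add, Nat.add_sub_cancel_left]
    ring

lemma polynomial (P : Polynomial ℂ) : Drawable fun s => P.eval ((s : ℝ) : ℂ) := by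
  obtain ⟨r, u, hu, hu1, him, hnear, hs⟩ := exists_near_one (2 * P.natDegree)
  obtain ⟨Q, hQ, hPQ⟩ := exists_laurent P r
  have hu0 : ∀ s, u s ≠ 0 := fun s => norm_ne_zero_iff.mp (by simp [hu1 s])
  have hN : ∀ (k : ℤ) (s : I), |k| ≤ (2 * P.natDegree : ℕ) → ‖u s ^ k - 1‖ ≤ 1 / 2 := by
    intro k s hk
    refine (norm_zpow_sub_one_le (hu1 s) k).trans (le_trans ?_ (hnear s))
    gcongr
    exact_mod_cast hk
  convert sum_zpow hu hu1 him hN Q.coeff (-(P.natDegree : ℤ)) le_rfl using 2 with s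
  have hpow : u s ^ P.natDegree ≠ 0 := pow_ne_zero _ (hu0 s)
  refine mul_right_cancel₀ hpow ?_
  rw [hs s, hPQ _ (hu0 s), Polynomial.eval_eq_sum_range' (Nat.lt_succ_of_le hQ), Finset.sum_mul]
  refine Finset.sum_congr rfl fun k _ => ?_
  rw [mul_assoc, ← zpow_natCast (u s) P.natDegree, ← zpow_add₀ (hu0 s), neg_add_cancel_right,
    zpow_natCast]

end Drawable

/-- A joint with a given path that is none of the base joints, even if its path is. -/
lemma exists_linkage_fresh {h f g : I → ℂ} (hf : Drawable f) (hg : Drawable g) (hh : Continuous h)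
    (dist_f : ∀ s, ‖h s - f s‖ = ‖h 0 - f 0‖) (dist_g : ∀ s, ‖h s - g s‖ = ‖h 0 - g 0‖)
    (im_ne : ∀ s, ((h s - f s) * conj (h s - g s)).im ≠ 0) :
    ∃ (Λ : Linkage) (v : Λ.V), Λ.path v = h ∧ ∀ i, Λ.base i ≠ v := by
  obtain ⟨Λ₁, -, hf⟩ := hf.exists_linkage Linkage.initial
  obtain ⟨Λ₂, hΛ₂, b, rfl⟩ := hg.exists_linkage Λ₁
  obtain ⟨a, rfl⟩ := hΛ₂ hf
  exact ⟨Λ₂.attach a b h hh dist_f dist_g im_ne, none, rfl, fun i => Option.some_ne_none _⟩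

/-! ### Transfer to the Euclidean plane -/

/-- The identification of `ℂ` with the Euclidean plane. -/
noncomputable def toPlane : ℂ ≃ₗᵢ[ℝ] Plane := Complex.orthonormalBasisOneI.repr

lemma toPlane_apply (z : ℂ) : toPlane z = !₂[z.re, z.im] := by
  simp [toPlane]
  ext i
  fin_cases i <;> rfl

/-- The framework formed by a linkage at input `0`. -/
noncomputable def Linkage.framework (Λ : Linkage) : BarJointFramework Λ.V where
  graph := Λ.graph
  pos v := toPlane (Λ.path v 0)
  pos_ne_of_adj v w h := toPlane.injective.ne (Λ.path_ne v w h)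

theorem theorem2 (γ : I → Plane) (hγ : IsPolynomialCurve γ) :
    ∃ (V : Type) (_ : Finite V) (F : BarJointFramework V) (v₁ v₂ vL vC : V),
      [v₁, v₂, vL, vC].Nodup ∧
      F.pos v₁ = !₂[0, 0] ∧ F.pos v₂ = !₂[1, 0] ∧ F.pos vL = !₂[1, 0] ∧ F.pos vC = γ 0 ∧
      (∀ (q : I → V → Plane) (s : I → I), F.IsMotion q →
        (∀ t, q t v₁ = F.pos v₁) → (∀ t, q t v₂ = F.pos v₂) →
        (∀ t, q t vL = !₂[1 + (s t : ℝ), 0]) →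
        ∀ t, q t vC = γ (s t)) ∧
      (∃ q : I → V → Plane, F.IsMotion q ∧
        (∀ t, q t v₁ = F.pos v₁) ∧ (∀ t, q t v₂ = F.pos v₂) ∧
        (∀ t, q t vL = !₂[1 + (t : ℝ), 0])) := by
  obtain ⟨X, Y, hXY⟩ := hγ
  obtain ⟨P, hP⟩ : ∃ P : Polynomial ℂ, ∀ s : I, toPlane (P.eval ((s : ℝ) : ℂ)) = γ s := by
    refine ⟨X.map Complex.ofRealHom + Polynomial.C Complex.I * Y.map Complex.ofRealHom,
      fun s => ?_⟩
    have h : ∀ Z : Polynomial ℝ, (Z.map Complex.ofRealHom).eval ((s : ℝ) : ℂ)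
        = ((Z.eval (s : ℝ) : ℝ) : ℂ) := fun Z => Polynomial.eval_map_apply (f := Complex.ofRealHom) s
    rw [hXY, toPlane_apply, Polynomial.eval_add, Polynomial.eval_mul, Polynomial.eval_C, h, h]
    simp
  have hadd : ∀ c : ℂ, Drawable fun s => P.eval ((s : ℝ) : ℂ) + c := fun c => by
    simpa using Drawable.polynomial (P + Polynomial.C c)
  obtain ⟨Λ, vC, hC, hbase⟩ := exists_linkage_fresh (hadd 1) (hadd Complex.I)
    (Drawable.polynomial P).continuous (by simp) (by simp) (by simp)
  have hpath : ∀ i s, Λ.path (Λ.base i) s = baseCurve i s := fun i s => by rw [Λ.path_base]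
  have hb0 : ∀ s, toPlane (baseCurve 0 s) = !₂[0, 0] := fun s => by
    simp [toPlane_apply, baseCurve]
  have hb1 : ∀ s, toPlane (baseCurve 1 s) = !₂[1, 0] := fun s => by
    simp [toPlane_apply, baseCurve]
  have hb2 : ∀ s : I, toPlane (baseCurve 2 s) = !₂[1 + (s : ℝ), 0] := fun s => by
    simp [toPlane_apply, baseCurve]
  have hpos : ∀ i, Λ.framework.pos (Λ.base i) = toPlane (baseCurve i 0) := fun i =>
    congrArg toPlane (hpath i 0)
  refine ⟨Λ.V, Λ.finite, Λ.framework, Λ.base 0, Λ.base 1, Λ.base 2, vC, ?_, ?_, ?_, ?_, ?_, ?_, ?_⟩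
  · simp [Λ.base_injective.eq_iff, hbase]
  · rw [hpos, hb0]
  · rw [hpos, hb1]
  · rw [hpos, hb2]
    simp
  · rw [← hP]
    exact congrArg toPlane (congrFun hC 0)
  · intro q s hq h1 h2 hL t
    have hs : Continuous s := by
      have : Continuous fun t => q t (Λ.base 2) 0 - 1 :=
        ((EuclideanSpace.proj (𝕜 := ℝ) (0 : Fin 2)).continuous.comp
          (hq.continuous_joint _)).sub continuous_const
      refine continuous_induced_rng.mpr ?_
      simpa [hL, Function.comp_def] using this
    have hs0 : s 0 = 0 := by
      have : q 0 (Λ.base 2) = !₂[1, 0] := by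
        rw [hq.start, hpos, hb2]
        simp
      rw [hL] at this
      have := congrArg (fun p : Plane => p 0) this
      exact Subtype.ext (by simpa using this)
    have key := Λ.rigid (fun t v => toPlane.symm (q t v)) s hs hs0
      (fun v => toPlane.symm.continuous.comp (hq.continuous_joint v))
      (fun v => by
        rw [hq.start]
        exact toPlane.symm_apply_apply _)
      (fun t v w hvw => by
        rw [toPlane.symm.dist_map, hq.dist_eq t v w hvw]
        exact toPlane.dist_map _ _)
      (fun i t => by
        rw [LinearIsometryEquiv.symm_apply_eq]
        fin_cases i
        · exact (h1 t).trans ((hpos 0).trans ((hb0 _).trans (hb0 _).symm))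
        · exact (h2 t).trans ((hpos 1).trans ((hb1 _).trans (hb1 _).symm))
        · exact (hL t).trans (hb2 _).symm) t vC
    rw [← hP, ← toPlane.apply_symm_apply (q t vC), key, hC]
  · refine ⟨fun t v => toPlane (Λ.path v t), ⟨fun v => ?_, rfl, fun t v w hvw => ?_⟩, fun t => ?_,
      fun t => ?_, fun t => ?_⟩
    · exact toPlane.continuous.comp (Λ.continuous_path v)
    · rw [toPlane.dist_map, Λ.dist_path v w hvw t]
      exact (toPlane.dist_map _ _).symm
    · rw [hpos, hb0, ← hb0 t, ← hpath]
    · rw [hpos, hb1, ← hb1 t, ← hpath]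
    · rw [← hb2 t, ← hpath]
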